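/- For $n\in\{0,1,2,\ldots\}$ let $H_n=\sum_{0<j\le n}\frac1j$ denote the $n$th harmonic number (so $H_0=0$). Then $$\sum_{k=1}^{\infty}\frac{(-27)^k}{k^3\binom{2k}{k}^2\binom{3k}{k}}\Bigl((15k-4)\bigl(3H_{3k-1}-H_{k-1}\bigr)-9\Bigr)=-\frac{4\pi^3}{\sqrt3},$$ where the series converges absolutely. -/

import Mathlib

open Finset Filter Topology

/-! This is a Wilf–Zeilberger acceleration. Differentiating a hypergeometric pair in `y` brings in
logarithmic derivatives, the source of the harmonic numbers, and preserves the relation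
`wzF_sub_wzF_succ`. Summing it over a rectangle telescopes both ways; the far edges vanish by
`abs_wzF_le` and `abs_wzG_le`, so `∑ wzG k 0 = ∑ wzF 0 n`. The left side is the given series shifted
by one. The right side is `-81 L(3, χ)`, with `χ` the nontrivial character mod 3, which the Fourier
series of the Bernoulli polynomial `B₃` at `1/3` evaluates. -/

/-- The `j`-th factor `(y + 1/3 + j)(y + 2/3 + j)` of the double Pochhammer product. -/
noncomputable def quadFactor (y : ℝ) (j : ℕ) : ℝ := (y + 1 / 3 + j) * (y + 2 / 3 + j)

/-- The ratio of consecutive coefficients of the accelerated series. -/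
noncomputable def coeffRatio (j : ℕ) : ℝ :=
  ((j : ℝ) + 1) ^ 4 * (j + 2 / 3) * (j + 4 / 3) / ((2 * j + 1) * (2 * j + 2))

/-- The common hypergeometric weight of the Wilf–Zeilberger pair. -/
noncomputable def wzWeight (k : ℕ) (y : ℝ) : ℝ :=
  (∏ j ∈ range k, -coeffRatio j) / (∏ j ∈ range (k + 1), quadFactor y j) ^ 2

/-- The logarithmic derivative of `∏ j ≤ k, quadFactor y j`. -/
noncomputable def logDerivSum (k : ℕ) (y : ℝ) : ℝ :=
  ∑ j ∈ range (k + 1), (1 / (y + 1 / 3 + j) + 1 / (y + 2 / 3 + j))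

/-- Half the derivative of `(2 * y + 1 + k) * wzWeight k y`. -/
noncomputable def wzF (k : ℕ) (y : ℝ) : ℝ :=
  wzWeight k y * (1 - (2 * y + 1 + k) * logDerivSum k y)

/-- Half the derivative of the Wilf–Zeilberger companion of `(2 * y + 1 + k) * wzWeight k y`. -/
noncomputable def wzG (k : ℕ) (y : ℝ) : ℝ :=
  wzWeight k y * ((2 * y + 3 * k + 2) / (2 * (2 * k + 1)) -
    (9 * y ^ 2 + (27 * k + 18) * y + (15 * k + 11) * (3 * k + 2) / 2) / (9 * (2 * k + 1)) *
      logDerivSum k y)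

/-! ### The telescoping relation -/

theorem quadFactor_pos {y : ℝ} (hy : 0 ≤ y) (j : ℕ) : 0 < quadFactor y j := by
  unfold quadFactor; positivity

theorem coeffRatio_pos (j : ℕ) : 0 < coeffRatio j := by
  unfold coeffRatio; positivity

theorem wzWeight_succ (k : ℕ) (y : ℝ) :
    wzWeight (k + 1) y = wzWeight k y * (-coeffRatio k / quadFactor y (k + 1) ^ 2) := by
  unfold wzWeight
  rw [prod_range_succ, prod_range_succ _ (k + 1), mul_pow, mul_div_mul_comm]

theorem wzWeight_add_one (k : ℕ) {y : ℝ} (hy : 0 ≤ y) :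
    wzWeight k (y + 1) = wzWeight k y * (quadFactor y 0 / quadFactor y (k + 1)) ^ 2 := by
  have hshift : ∀ j : ℕ, quadFactor (y + 1) j = quadFactor y (j + 1) := fun j => by
    unfold quadFactor; push_cast; ring
  have h : (∏ j ∈ range (k + 1), quadFactor (y + 1) j) * quadFactor y 0 =
      (∏ j ∈ range (k + 1), quadFactor y j) * quadFactor y (k + 1) := by
    rw [← prod_range_succ, prod_range_succ' _ (k + 1), prod_congr rfl fun j _ => hshift j]
  have h0 := (quadFactor_pos hy 0).ne'
  have h1 := (quadFactor_pos hy (k + 1)).ne'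
  have hp : (∏ j ∈ range (k + 1), quadFactor y j) ≠ 0 :=
    prod_ne_zero_iff.2 fun j _ => (quadFactor_pos hy j).ne'
  unfold wzWeight
  rw [eq_div_of_mul_eq h0 h]
  field_simp

theorem logDerivSum_succ (k : ℕ) (y : ℝ) :
    logDerivSum (k + 1) y =
      logDerivSum k y + (1 / (y + 1 / 3 + (k + 1)) + 1 / (y + 2 / 3 + (k + 1))) := by
  unfold logDerivSum
  rw [sum_range_succ _ (k + 1)]; push_cast; rfl

theorem logDerivSum_add_one (k : ℕ) (y : ℝ) :
    logDerivSum k (y + 1) = logDerivSum k y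
      + (1 / (y + 1 / 3 + (k + 1)) + 1 / (y + 2 / 3 + (k + 1)))
      - (1 / (y + 1 / 3) + 1 / (y + 2 / 3)) := by
  rw [← logDerivSum_succ]
  unfold logDerivSum
  rw [sum_range_succ' _ (k + 1)]
  simp only [Nat.cast_zero, add_zero, add_sub_cancel_right]
  refine sum_congr rfl fun j _ => ?_
  push_cast
  congr 2 <;> ring

theorem wzF_sub_wzF_succ (k : ℕ) {y : ℝ} (hy : 0 ≤ y) :
    wzF k y - wzF (k + 1) y = wzG k y - wzG k (y + 1) := by
  unfold wzF wzG
  rw [wzWeight_succ, wzWeight_add_one k hy, logDerivSum_succ, logDerivSum_add_one]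
  -- After the shift rules, both sides are linear in `L` and proportional to `w`, so a
  -- rational-function identity remains.
  generalize wzWeight k y = w
  generalize logDerivSum k y = L
  unfold coeffRatio quadFactor
  push_cast
  have hk : (0 : ℝ) ≤ k := k.cast_nonneg
  generalize (k : ℝ) = x at hk
  have h1 : y + 1 / 3 ≠ 0 := by positivity
  have h2 : y + 2 / 3 ≠ 0 := by positivity
  have h3 : y + 1 / 3 + (x + 1) ≠ 0 := by positivity
  have h4 : y + 2 / 3 + (x + 1) ≠ 0 := by positivity
  have h5 : 2 * x + 1 ≠ 0 := by positivity
  have h6 : 2 * x + 2 ≠ 0 := by positivity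
  simp only [add_zero]
  field_simp
  ring

/-! ### Decay estimates -/

/-- In absolute value, the ratio of consecutive weights is largest at `n = 0`, where it stays below
its limit `1/4` as `k → ∞`. The constant 21 covers `(9/2)² = 20.25` from `k = 0`. -/
theorem abs_wzWeight_le (k n : ℕ) :
    |wzWeight k n| ≤ 21 / ((n : ℝ) + 1) ^ 4 * (1 / 4) ^ k := by
  have hn : (0 : ℝ) ≤ n := n.cast_nonneg
  induction k with
  | zero =>
    have h : 2 / 9 * ((n : ℝ) + 1) ^ 2 ≤ quadFactor n 0 := by
      simp only [quadFactor, Nat.cast_zero]; nlinarith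
    simp only [wzWeight, range_zero, prod_empty, zero_add, range_one, prod_singleton, pow_zero,
      mul_one]
    rw [abs_of_nonneg (by positivity), div_le_div_iff₀ (pow_pos (quadFactor_pos hn 0) 2)
      (by positivity)]
    have := pow_le_pow_left₀ (by positivity) h 2
    nlinarith [pow_pos (show (0 : ℝ) < n + 1 by positivity) 4]
  | succ k ih =>
    rw [wzWeight_succ, abs_mul, pow_succ (1 / 4 : ℝ), ← mul_assoc]
    refine mul_le_mul ih ?_ (abs_nonneg _) (by positivity)
    rw [abs_div, abs_neg, abs_of_pos (coeffRatio_pos k), abs_of_nonneg (sq_nonneg _)]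
    have h : ((k : ℝ) + 4 / 3) * (k + 5 / 3) ≤ quadFactor n (k + 1) := by
      unfold quadFactor; push_cast
      exact mul_le_mul (by linarith) (by linarith) (by positivity) (by positivity)
    have h2 := pow_le_pow_left₀ (by positivity) h 2
    refine (div_le_div_of_nonneg_left (coeffRatio_pos k).le (by positivity) h2).trans ?_
    unfold coeffRatio
    have hk : (0 : ℝ) ≤ k := k.cast_nonneg
    generalize (k : ℝ) = x at hk
    rw [div_div, div_le_div_iff₀ (by positivity) (by positivity), ← sub_nonneg]
    have : (1 : ℝ) * ((2 * x + 1) * (2 * x + 2) * ((x + 4 / 3) * (x + 5 / 3)) ^ 2)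
        - (x + 1) ^ 4 * (x + 2 / 3) * (x + 4 / 3) * 4 =
        (x + 1) * (x + 4 / 3) * (6 * x ^ 3 + 164 / 9 * x ^ 2 + 466 / 27 * x + 128 / 27) := by
      ring
    rw [this]; positivity

theorem logDerivSum_nonneg (k n : ℕ) : 0 ≤ logDerivSum k n := by
  unfold logDerivSum; positivity

theorem logDerivSum_le (k n : ℕ) : logDerivSum k n ≤ 5 * ((k : ℝ) + 1) := by
  have h : ∀ j ∈ range (k + 1), 1 / ((n : ℝ) + 1 / 3 + j) + 1 / ((n : ℝ) + 2 / 3 + j) ≤ 5 := by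
    intro j _
    have hn : (0 : ℝ) ≤ n := n.cast_nonneg
    have hj : (0 : ℝ) ≤ j := j.cast_nonneg
    have h1 : 1 / ((n : ℝ) + 1 / 3 + j) ≤ 3 := by
      rw [div_le_iff₀ (by positivity)]; linarith
    have h2 : 1 / ((n : ℝ) + 2 / 3 + j) ≤ 2 := by
      rw [div_le_iff₀ (by positivity)]; linarith
    linarith
  have := sum_le_card_nsmul _ _ _ h
  rw [card_range, nsmul_eq_mul] at this
  push_cast at this
  unfold logDerivSum
  linarith

theorem abs_wzF_le (k n : ℕ) :
    |wzF k n| ≤ 231 * (((k : ℝ) + 1) ^ 2 * (1 / 4) ^ k) * (1 / ((n : ℝ) + 1) ^ 3) := by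
  have hn : (0 : ℝ) ≤ n := n.cast_nonneg
  have hk : (0 : ℝ) ≤ k := k.cast_nonneg
  have hL := logDerivSum_le k n
  have hL0 := logDerivSum_nonneg k n
  have h : |1 - (2 * (n : ℝ) + 1 + k) * logDerivSum k n| ≤ 11 * ((n : ℝ) + 1) * ((k : ℝ) + 1) ^ 2 := by
    have h1 : (2 * (n : ℝ) + 1 + k) * logDerivSum k n ≤
        (2 * (n + 1) * (k + 1)) * (5 * (k + 1)) :=
      mul_le_mul (by nlinarith) hL hL0 (by positivity)
    have h0 : 0 ≤ (2 * (n : ℝ) + 1 + k) * logDerivSum k n := by positivity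
    have h2 : (1 : ℝ) ≤ (n + 1) * (k + 1) ^ 2 := by nlinarith [mul_nonneg hn hk]
    rw [abs_le]; constructor <;> nlinarith
  unfold wzF
  rw [abs_mul]
  refine (mul_le_mul (abs_wzWeight_le k n) h (abs_nonneg _) (by positivity)).trans_eq ?_
  field_simp
  ring

theorem abs_wzG_le (k n : ℕ) :
    |wzG k n| ≤ 588 * (((k : ℝ) + 1) ^ 3 * (1 / 4) ^ k) * (1 / ((n : ℝ) + 1) ^ 2) := by
  have hn : (0 : ℝ) ≤ n := n.cast_nonneg
  have hk : (0 : ℝ) ≤ k := k.cast_nonneg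
  have hL := logDerivSum_le k n
  have hL0 := logDerivSum_nonneg k n
  have hnk := mul_nonneg hn hk
  have h : |(2 * (n : ℝ) + 3 * k + 2) / (2 * (2 * k + 1)) -
      (9 * (n : ℝ) ^ 2 + (27 * k + 18) * n + (15 * k + 11) * (3 * k + 2) / 2) /
        (9 * (2 * k + 1)) * logDerivSum k n| ≤
        28 * ((n : ℝ) + 1) ^ 2 * ((k : ℝ) + 1) ^ 3 := by
    have hone : (1 : ℝ) ≤ (n + 1) * (k + 1) ^ 2 := by nlinarith
    have h1 : (2 * (n : ℝ) + 3 * k + 2) / (2 * (2 * k + 1)) ≤ 3 * (n + 1) ^ 2 * (k + 1) ^ 3 := by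
      rw [div_le_iff₀ (by positivity)]
      have : (n + 1) * (k + 1) * 1 ≤ ((n : ℝ) + 1) * (k + 1) * ((n + 1) * (k + 1) ^ 2) := by
        gcongr
      have h3 : 0 ≤ (3 * ((n : ℝ) + 1) ^ 2 * (k + 1) ^ 3) * (2 * (2 * k)) := by positivity
      nlinarith
    have h2 : (9 * (n : ℝ) ^ 2 + (27 * k + 18) * n + (15 * k + 11) * (3 * k + 2) / 2) /
        (9 * (2 * k + 1)) ≤ 5 * (n + 1) ^ 2 * (k + 1) ^ 2 := by
      rw [div_le_iff₀ (by positivity)]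
      have h3 : 0 ≤ (5 * ((n : ℝ) + 1) ^ 2 * (k + 1) ^ 2) * (9 * (2 * k)) := by positivity
      have h4 : 0 ≤ (n : ℝ) ^ 2 * k := by positivity
      have h5 : 0 ≤ (n : ℝ) ^ 2 * k ^ 2 := by positivity
      have h6 : 0 ≤ (n : ℝ) * k ^ 2 := by positivity
      nlinarith
    have h3 := mul_le_mul h2 hL hL0 (by positivity)
    have h1' : 0 ≤ (2 * (n : ℝ) + 3 * k + 2) / (2 * (2 * k + 1)) := by positivity
    have h3' : 0 ≤ (9 * (n : ℝ) ^ 2 + (27 * k + 18) * n + (15 * k + 11) * (3 * k + 2) / 2) /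
        (9 * (2 * k + 1)) * logDerivSum k n := by positivity
    have hp : 0 ≤ ((n : ℝ) + 1) ^ 2 * (k + 1) ^ 3 := by positivity
    rw [abs_le]; constructor <;> nlinarith
  unfold wzG
  rw [abs_mul]
  refine (mul_le_mul (abs_wzWeight_le k n) h (abs_nonneg _) (by positivity)).trans_eq ?_
  field_simp
  ring

theorem summable_one_div_succ_pow_three : Summable fun n : ℕ => 1 / ((n : ℝ) + 1) ^ 3 := by
  have := (summable_nat_add_iff 1).2 (Real.summable_one_div_nat_pow.2 (by norm_num : 1 < 3))
  simpa using this

theorem summable_succ_pow_mul_geometric (m : ℕ) :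
    Summable fun k : ℕ => ((k : ℝ) + 1) ^ m * (1 / 4) ^ k := by
  have := (summable_nat_add_iff 1).2
    (summable_pow_mul_geometric_of_norm_lt_one m (r := (1 / 4 : ℝ)) (by norm_num))
  refine (this.mul_left 4).congr fun k => ?_
  push_cast
  ring

theorem summable_wzF (k : ℕ) : Summable fun n : ℕ => wzF k n :=
  .of_norm_bounded (summable_one_div_succ_pow_three.mul_left _) fun n => abs_wzF_le k n

theorem summable_wzG_zero : Summable fun k : ℕ => wzG k 0 :=
  .of_norm_bounded ((summable_succ_pow_mul_geometric 3).mul_left 588) fun k => by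
    simpa using abs_wzG_le k 0

theorem tendsto_wzG (k : ℕ) : Tendsto (fun n : ℕ => wzG k n) atTop (𝓝 0) := by
  refine squeeze_zero_norm (fun n => abs_wzG_le k n) ?_
  have h : Tendsto (fun n : ℕ => (1 / ((n : ℝ) + 1)) ^ 2) atTop (𝓝 0) := by
    simpa using tendsto_one_div_add_atTop_nhds_zero_nat (𝕜 := ℝ).pow 2
  simpa [div_pow] using h.const_mul (588 * (((k : ℝ) + 1) ^ 3 * (1 / 4) ^ k))

/-! ### Summation over rectangles and passage to the limit -/

theorem sum_wzF_sub (K N : ℕ) :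
    ∑ n ∈ range N, (wzF 0 n - wzF K n) = ∑ k ∈ range K, (wzG k 0 - wzG k N) := by
  have h1 : ∀ n : ℕ, wzF 0 n - wzF K n = ∑ k ∈ range K, (wzG k n - wzG k ((n + 1 : ℕ) : ℝ)) := by
    intro n
    rw [← sum_range_sub' (fun k => wzF k n) K]
    refine sum_congr rfl fun k _ => ?_
    rw [wzF_sub_wzF_succ k n.cast_nonneg]; push_cast; rfl
  simp_rw [h1]
  rw [sum_comm]
  refine sum_congr rfl fun k _ => ?_
  rw [sum_range_sub' (fun n : ℕ => wzG k n) N, Nat.cast_zero]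

theorem sum_wzG_zero (K : ℕ) :
    ∑ k ∈ range K, wzG k 0 = ∑' n : ℕ, wzF 0 n - ∑' n : ℕ, wzF K n := by
  have h1 := ((summable_wzF 0).hasSum.sub (summable_wzF K).hasSum).tendsto_sum_nat
  have h2 : Tendsto (fun N : ℕ => ∑ k ∈ range K, (wzG k 0 - wzG k N)) atTop
      (𝓝 (∑ k ∈ range K, (wzG k 0 - 0))) :=
    tendsto_finsetSum _ fun k _ => (tendsto_wzG k).const_sub _
  simp only [sum_wzF_sub, sub_zero] at h1 h2
  exact tendsto_nhds_unique h2 h1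

theorem tendsto_tsum_wzF : Tendsto (fun K : ℕ => ∑' n : ℕ, wzF K n) atTop (𝓝 0) := by
  refine squeeze_zero_norm (fun K => tsum_of_norm_bounded
    (summable_one_div_succ_pow_three.hasSum.mul_left _) fun n => abs_wzF_le K n) ?_
  have h := ((summable_succ_pow_mul_geometric 2).tendsto_atTop_zero.const_mul 231).mul_const
    (∑' n : ℕ, 1 / ((n : ℝ) + 1) ^ 3)
  rwa [mul_zero, zero_mul] at h

theorem hasSum_wzG_zero : HasSum (fun k : ℕ => wzG k 0) (∑' n : ℕ, wzF 0 n) := by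
  rw [summable_wzG_zero.hasSum_iff_tendsto_nat]
  simp_rw [sum_wzG_zero]
  simpa using tendsto_tsum_wzF.const_sub (∑' n : ℕ, wzF 0 n)

/-! ### The value of `L(3, χ)` -/

theorem sum_range_three_mul (F : ℕ → ℝ) (N : ℕ) :
    ∑ i ∈ range (3 * N), F i = ∑ n ∈ range N, (F (3 * n) + F (3 * n + 1) + F (3 * n + 2)) := by
  induction N with
  | zero => simp
  | succ N ih =>
    rw [sum_range_succ, ← ih, show 3 * (N + 1) = 3 * N + 1 + 1 + 1 by ring]
    simp only [sum_range_succ]; ring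

theorem sin_two_pi_mul_add_div_three (n r : ℕ) :
    Real.sin (2 * Real.pi * ((3 * n + r : ℕ) : ℝ) * (1 / 3)) =
      Real.sin (2 * Real.pi * r / 3) := by
  rw [← Real.sin_add_nat_mul_two_pi (2 * Real.pi * r / 3) n]
  congr 1
  push_cast
  ring

theorem sin_two_pi_div_three : Real.sin (2 * Real.pi / 3) = √3 / 2 := by
  rw [show 2 * Real.pi / 3 = Real.pi - Real.pi / 3 by ring, Real.sin_pi_sub,
    Real.sin_pi_div_three]

theorem sin_four_pi_div_three : Real.sin (4 * Real.pi / 3) = -(√3 / 2) := by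
  rw [show 4 * Real.pi / 3 = Real.pi / 3 + Real.pi by ring, Real.sin_add_pi,
    Real.sin_pi_div_three]

theorem bernoulli_three_eval_one_third : (Polynomial.bernoulli 3).eval (1 / 3 : ℚ) = 1 / 27 := by
  simp_rw [Polynomial.bernoulli, Finset.sum_range_succ, Polynomial.eval_add,
    Polynomial.eval_monomial]
  rw [Finset.sum_range_zero, Polynomial.eval_zero, zero_add, bernoulli_one]
  rw [bernoulli_eq_bernoulli'_of_ne_one zero_ne_one, bernoulli'_zero,
    bernoulli_eq_bernoulli'_of_ne_one (by decide : 2 ≠ 1), bernoulli'_two,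
    bernoulli_eq_bernoulli'_of_ne_one (by decide : 3 ≠ 1), bernoulli'_three]
  norm_num [Nat.choose]

theorem hasSum_sin_two_pi_div_three :
    HasSum (fun n : ℕ => 1 / (n : ℝ) ^ 3 * Real.sin (2 * Real.pi * n * (1 / 3)))
      (2 * Real.pi ^ 3 / 81) := by
  have h := hasSum_one_div_nat_pow_mul_sin one_ne_zero
    (x := 1 / 3) (Set.mem_Icc.2 ⟨by norm_num, by norm_num⟩)
  have hB : Polynomial.eval (1 / 3 : ℝ)
      (Polynomial.map (algebraMap ℚ ℝ) (Polynomial.bernoulli (2 * 1 + 1))) = 1 / 27 := by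
    rw [show (1 / 3 : ℝ) = algebraMap ℚ ℝ (1 / 3) by simp, Polynomial.eval_map_algebraMap,
      Polynomial.aeval_algebraMap_apply, Polynomial.coe_aeval_eq_eval,
      show 2 * 1 + 1 = 3 from rfl, bernoulli_three_eval_one_third]
    simp
  rw [hB] at h
  convert h using 1
  · rfl
  · simp [Nat.factorial]
    ring

theorem wzF_zero (n : ℕ) :
    wzF 0 n = -81 * (1 / (3 * (n : ℝ) + 1) ^ 3 - 1 / (3 * (n : ℝ) + 2) ^ 3) := by
  simp only [wzF, wzWeight, logDerivSum, quadFactor, range_zero, prod_empty, zero_add, range_one,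
    prod_singleton, sum_singleton, Nat.cast_zero, add_zero]
  have h1 : (n : ℝ) + 1 / 3 ≠ 0 := by positivity
  have h2 : (n : ℝ) + 2 / 3 ≠ 0 := by positivity
  rw [show 3 * (n : ℝ) + 1 = 3 * (n + 1 / 3) by ring,
    show 3 * (n : ℝ) + 2 = 3 * (n + 2 / 3) by ring]
  field_simp
  ring

theorem tsum_wzF_zero : ∑' n : ℕ, wzF 0 n = -(4 * Real.pi ^ 3) / √3 := by
  -- Partial sums up to `3N` group the sine series by residues mod 3. As `sin (2πm/3) = (√3/2)
  -- χ(m)`, the factor `-162/√3` produces `-81`.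
  have h := (hasSum_sin_two_pi_div_three.tendsto_sum_nat.comp
    (tendsto_id.const_mul_atTop' (r := 3) (by norm_num))).const_mul (-162 / √3)
  refine tendsto_nhds_unique (summable_wzF 0).hasSum.tendsto_sum_nat ?_
  have h3 : √3 ≠ 0 := by positivity
  convert h using 2 with N
  · simp only [Function.comp_apply, id]
    rw [sum_range_three_mul, mul_sum]
    refine sum_congr rfl fun n _ => ?_
    have e0 := sin_two_pi_mul_add_div_three n 0
    have e1 := sin_two_pi_mul_add_div_three n 1
    have e2 := sin_two_pi_mul_add_div_three n 2
    rw [add_zero, Nat.cast_zero, mul_zero, zero_div, Real.sin_zero] at e0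
    rw [Nat.cast_one, mul_one, sin_two_pi_div_three] at e1
    rw [show 2 * Real.pi * ((2 : ℕ) : ℝ) / 3 = 4 * Real.pi / 3 by push_cast; ring,
      sin_four_pi_div_three] at e2
    rw [e0, e1, e2, wzF_zero]
    push_cast
    field_simp
    ring
  · field_simp
    ring

/-! ### Identification with the binomial series -/

theorem choose_three_mul_succ (k : ℕ) :
    ((3 * (k + 1)).choose (k + 1) : ℝ) * ((k + 1) * (2 * k + 1) * (2 * k + 2)) =
      ((3 * k).choose k : ℝ) * ((3 * k + 1) * (3 * k + 2) * (3 * k + 3)) := by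
  have h1 := Nat.choose_mul_factorial_mul_factorial (show k ≤ 3 * k by omega)
  have h2 := Nat.choose_mul_factorial_mul_factorial (show k + 1 ≤ 3 * (k + 1) by omega)
  rw [show 3 * k - k = 2 * k by omega] at h1
  rw [show 3 * (k + 1) - (k + 1) = 2 * k + 1 + 1 by omega,
    show (3 * (k + 1)).factorial = (3 * k + 1 + 1 + 1).factorial from rfl] at h2
  simp only [Nat.factorial_succ] at h2
  rw [← h1] at h2
  have h2' := congrArg (Nat.cast (R := ℝ)) h2
  push_cast at h2'
  have hk : (k.factorial : ℝ) ≠ 0 := by positivity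
  have hk2 : ((2 * k).factorial : ℝ) ≠ 0 := by positivity
  refine mul_right_cancel₀ (mul_ne_zero hk hk2) ?_
  linear_combination h2'

theorem choose_two_mul_succ (k : ℕ) :
    ((2 * (k + 1)).choose (k + 1) : ℝ) * (k + 1) = ((2 * k).choose k : ℝ) * (2 * (2 * k + 1)) := by
  have h := congrArg (Nat.cast (R := ℝ)) (Nat.succ_mul_centralBinom_succ k)
  simp only [Nat.centralBinom] at h
  push_cast at h
  linear_combination h

/-- The multiples of 3 in `3 H_{3k+2}` contribute exactly `H_k`; the other two residue classes give
the two sums in `logDerivSum`. -/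
theorem three_mul_harmonic_sub_harmonic (k : ℕ) :
    3 * (harmonic (3 * k + 2) : ℝ) - (harmonic k : ℝ) = logDerivSum k 0 := by
  induction k with
  | zero => norm_num [harmonic, logDerivSum, sum_range_succ]
  | succ k ih =>
    rw [logDerivSum_succ, ← ih, show 3 * (k + 1) + 2 = 3 * k + 2 + 1 + 1 + 1 by ring]
    rw [harmonic_succ (3 * k + 2 + 1 + 1), harmonic_succ (3 * k + 2 + 1), harmonic_succ (3 * k + 2),
      harmonic_succ k]
    generalize harmonic (3 * k + 2) = a
    push_cast
    have h1 : (k : ℝ) + 1 ≠ 0 := by positivity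
    have h2 : 3 * (k : ℝ) + 4 ≠ 0 := by positivity
    have h3 : 3 * (k : ℝ) + 5 ≠ 0 := by positivity
    rw [show 3 * (k : ℝ) + 2 + 1 + 1 + 1 = 3 * k + 5 by ring,
      show 3 * (k : ℝ) + 2 + 1 + 1 = 3 * k + 4 by ring,
      show 3 * (k : ℝ) + 2 + 1 = 3 * (k + 1) by ring,
      show (0 : ℝ) + 1 / 3 + (k + 1) = (3 * k + 4) / 3 by ring,
      show (0 : ℝ) + 2 / 3 + (k + 1) = (3 * k + 5) / 3 by ring]
    field_simp
    ring

theorem coeff_eq_wzWeight (k : ℕ) :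
    (-27 : ℝ) ^ (k + 1) / (((k : ℝ) + 1) ^ 3 * ((2 * (k + 1)).choose (k + 1) : ℝ) ^ 2 *
      ((3 * (k + 1)).choose (k + 1) : ℝ)) =
      -(wzWeight k 0 * (3 * k + 2) / (18 * (2 * k + 1))) := by
  induction k with
  | zero =>
    norm_num [wzWeight, quadFactor, Nat.choose]
  | succ k ih =>
    have e2 := choose_two_mul_succ (k + 1)
    have e3 := choose_three_mul_succ (k + 1)
    have p2 : (0 : ℝ) < ((2 * (k + 1)).choose (k + 1) : ℝ) :=
      mod_cast Nat.choose_pos (by omega)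
    have p3 : (0 : ℝ) < ((3 * (k + 1)).choose (k + 1) : ℝ) :=
      mod_cast Nat.choose_pos (by omega)
    push_cast at e2 e3
    rw [← eq_div_iff (by positivity)] at e2 e3
    rw [e2, e3, wzWeight_succ]
    have hw : wzWeight k 0 = -((-27 : ℝ) ^ (k + 1) / (((k : ℝ) + 1) ^ 3 *
        ((2 * (k + 1)).choose (k + 1) : ℝ) ^ 2 * ((3 * (k + 1)).choose (k + 1) : ℝ))) *
        (18 * (2 * k + 1)) / (3 * k + 2) := by
      rw [ih]; field_simp
    rw [hw, pow_succ (-27 : ℝ) (k + 1)]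
    unfold coeffRatio quadFactor
    push_cast
    generalize (-27 : ℝ) ^ (k + 1) = q
    generalize ((2 * (k + 1)).choose (k + 1) : ℝ) = b at p2 ⊢
    generalize ((3 * (k + 1)).choose (k + 1) : ℝ) = c at p3 ⊢
    have hk : (0 : ℝ) ≤ k := k.cast_nonneg
    generalize (k : ℝ) = x at hk ⊢
    rw [show (0 : ℝ) + 1 / 3 + (x + 1) = (3 * x + 4) / 3 by ring,
      show (0 : ℝ) + 2 / 3 + (x + 1) = (3 * x + 5) / 3 by ring,
      show x + 2 / 3 = (3 * x + 2) / 3 by ring, show x + 4 / 3 = (3 * x + 4) / 3 by ring,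
      show 3 * (x + 1) + 1 = 3 * x + 4 by ring, show 3 * (x + 1) + 2 = 3 * x + 5 by ring,
      show 3 * (x + 1) + 3 = 3 * (x + 2) by ring, show x + 1 + 1 = x + 2 by ring,
      show 2 * (x + 1) + 1 = 2 * x + 3 by ring, show 2 * (x + 1) + 2 = 2 * (x + 2) by ring,
      show 2 * x + 2 = 2 * (x + 1) by ring]
    field_simp
    ring

theorem theorem1p1 :
    HasSum
      (fun k : ℕ+ =>
        (-27 : ℝ) ^ (k : ℕ) /
            ((k : ℝ) ^ 3 * (Nat.choose (2 * (k : ℕ)) (k : ℕ) : ℝ) ^ 2 *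
              (Nat.choose (3 * (k : ℕ)) (k : ℕ) : ℝ)) *
          ((15 * (k : ℝ) - 4) *
              (3 * (harmonic (3 * (k : ℕ) - 1) : ℝ) - (harmonic ((k : ℕ) - 1) : ℝ)) - 9))
      (-(4 * Real.pi ^ 3) / Real.sqrt 3) := by
  rw [← tsum_wzF_zero, ← Equiv.pnatEquivNat.symm.hasSum_iff]
  convert hasSum_wzG_zero using 1
  funext k
  -- The positive index is `k + 1`, matching `wzG k 0`.
  have hk : ((Equiv.pnatEquivNat.symm k : ℕ+) : ℕ) = k + 1 := rfl
  simp only [Function.comp_apply, hk]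
  rw [show 3 * (k + 1) - 1 = 3 * k + 2 by omega, Nat.add_sub_cancel,
    three_mul_harmonic_sub_harmonic, Nat.cast_succ, coeff_eq_wzWeight, wzG]
  field_simp
  ring
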